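/- There is a universal constant $C>0$ such that the following holds. Let $n$ be a natural number, let $x_1,\ldots,x_n\in[0,1]$, and let $\varphi\colon[0,1]^n\to\mathbb{R}$ be a convex function which is $L$-Lipschitz with respect to the Euclidean norm, where $L\ge 0$. Let $\pi$ be a uniformly distributed random permutation of $\{1,\ldots,n\}$, defined on some probability space, and let $Z=\varphi(x_{\pi(1)},\ldots,x_{\pi(n)})$. Then for every real $p\ge 2$, \[ \|Z\|_p\le\|Z\|_1+C\,L\,\sqrt{p}, \] where $\|Z\|_q=(\mathbb{E}|Z|^q)^{1/q}$ for $1\le q<\infty$. -/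

import Mathlib

open MeasureTheory
open scoped NNReal ENNReal Nat

/-- The cube `[0,1]^n`, inside Euclidean space `ℝ^n`. -/
def unitCube (n : ℕ) : Set (EuclideanSpace ℝ (Fin n)) :=
  {v | ∀ i, v i ∈ Set.Icc (0 : ℝ) 1}

/-- `π` is a random uniform permutation of an `n`-element set: it is a random variable
(with values in the finite set of permutations) taking each value with probability `1 / n!`. -/
def IsUniformPermutation {Ω : Type*} [MeasurableSpace Ω] (P : Measure Ω) {n : ℕ}
    (π : Ω → Equiv.Perm (Fin n)) : Prop :=
  ∀ σ : Equiv.Perm (Fin n),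
    MeasurableSet (π ⁻¹' {σ}) ∧ P (π ⁻¹' {σ}) = ((n ! : ℕ) : ℝ≥0∞)⁻¹

/-- The permuted vector `(x_{σ(1)}, …, x_{σ(n)})`. -/
def permutedVector {n : ℕ} (x : Fin n → ℝ) (σ : Equiv.Perm (Fin n)) :
    EuclideanSpace ℝ (Fin n) :=
  WithLp.toLp 2 fun i => x (σ i)

/-! The engine is a convex distance inequality on the symmetric group: for closed convex `K` in the
cube and `h σ` the squared distance from `permutedVector x σ` to `K`, the mean of `exp (h / 30)`
times the squared probability of lying in `K` is at most 1. The entropy of a function of a random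
permutation is controlled by its increments under transpositions (`entropy_agreeOff_le`, by
conditioning on one value). The slope of the squared distance has norm twice the distance, so
squared decreases of `h` over all transpositions sum to at most `8 n h`. Herbst's argument, run for
both signs of the parameter, turns this into the exponential inequality.

Sublevel sets of `f` are convex, and the excess of `f` over a level is at most `L` times the
distance to that sublevel set. The level at a median gives the upper tail. For the lower tail each
`σ` uses its own value as level: the resulting bound involves the rank of `σ`, and inverse square
roots of ranks are summable. Subgaussian moments about a median `m` follow, and `|m|` is compared
with the first moment by the triangle inequality. -/

open Finset Equiv

/-! ### Log-sum and entropy inequalities on a finite set. -/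

/-- The integrand of the modified logarithmic Sobolev energy. -/
noncomputable def logGap (u v : ℝ) : ℝ := (u - v) * (Real.log u - Real.log v)

theorem logGap_self (u : ℝ) : logGap u u = 0 := by simp [logGap]

theorem logGap_nonneg {u v : ℝ} (hu : 0 < u) (hv : 0 < v) : 0 ≤ logGap u v := by
  unfold logGap
  rcases le_total u v with h | h
  · exact mul_nonneg_of_nonpos_of_nonpos (by linarith) (by linarith [Real.log_le_log hu h])
  · exact mul_nonneg (by linarith) (by linarith [Real.log_le_log hv h])

/-- The log-sum inequality. -/
theorem log_sum_le {ι : Type*} (s : Finset ι) (u v : ι → ℝ) (hs : s.Nonempty)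
    (hu : ∀ i ∈ s, 0 < u i) (hv : ∀ i ∈ s, 0 < v i) :
    (∑ i ∈ s, u i) * (Real.log (∑ i ∈ s, u i) - Real.log (∑ i ∈ s, v i)) ≤
      ∑ i ∈ s, u i * (Real.log (u i) - Real.log (v i)) := by
  have hU : 0 < ∑ i ∈ s, u i := sum_pos hu hs
  have hV : 0 < ∑ i ∈ s, v i := sum_pos hv hs
  set U := ∑ i ∈ s, u i with hUd
  set V := ∑ i ∈ s, v i with hVd
  -- The bound `log t ≤ t - 1` at `t = v i * U / (u i * V)`, times `u i`; the linear corrections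
  -- cancel on summation.
  have key : ∀ i ∈ s, u i * (Real.log U - Real.log V) + u i - v i * (U / V) ≤
      u i * (Real.log (u i) - Real.log (v i)) := by
    intro i hi
    have hui := hu i hi
    have hvi := hv i hi
    have h := Real.log_le_sub_one_of_pos (x := v i * U / (u i * V)) (by positivity)
    rw [Real.log_div (by positivity) (by positivity), Real.log_mul hvi.ne' hU.ne',
      Real.log_mul hui.ne' hV.ne'] at h
    have h2 := mul_le_mul_of_nonneg_left h hui.le
    have h3 : u i * (v i * U / (u i * V) - 1) = v i * (U / V) - u i := by
      field_simp
    linarith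
  refine le_trans (le_of_eq ?_) (sum_le_sum key)
  rw [sum_sub_distrib, sum_add_distrib, ← sum_mul, ← sum_mul, ← hUd, ← hVd]
  field_simp
  ring

theorem logGap_sum_le {ι : Type*} (s : Finset ι) (u v : ι → ℝ) (hs : s.Nonempty)
    (hu : ∀ i ∈ s, 0 < u i) (hv : ∀ i ∈ s, 0 < v i) :
    logGap (∑ i ∈ s, u i) (∑ i ∈ s, v i) ≤ ∑ i ∈ s, logGap (u i) (v i) := by
  have h1 := log_sum_le s u v hs hu hv
  have h2 := log_sum_le s v u hs hv hu
  have h3 : ∑ i ∈ s, logGap (u i) (v i) =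
      ∑ i ∈ s, u i * (Real.log (u i) - Real.log (v i)) +
        ∑ i ∈ s, v i * (Real.log (v i) - Real.log (u i)) := by
    rw [← sum_add_distrib]
    exact sum_congr rfl fun i _ => by unfold logGap; ring
  rw [h3]
  unfold logGap
  linarith

/-- The modified logarithmic Sobolev inequality on the complete graph. -/
theorem entropy_le_sum_logGap {ι : Type*} (s : Finset ι) (u : ι → ℝ) (hs : s.Nonempty)
    (hu : ∀ i ∈ s, 0 < u i) :
    ∑ i ∈ s, u i * Real.log (u i) - (∑ i ∈ s, u i) * Real.log ((∑ i ∈ s, u i) / #s) ≤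
      1 / (2 * #s) * ∑ i ∈ s, ∑ j ∈ s, logGap (u i) (u j) := by
  have hU : 0 < ∑ i ∈ s, u i := sum_pos hu hs
  have hn : (0 : ℝ) < #s := by exact_mod_cast hs.card_pos
  have h1 : ∑ i ∈ s, ∑ j ∈ s, logGap (u i) (u j) =
      2 * #s * ∑ i ∈ s, u i * Real.log (u i) -
        2 * ((∑ i ∈ s, u i) * ∑ i ∈ s, Real.log (u i)) := by
    have : ∀ i ∈ s, ∑ j ∈ s, logGap (u i) (u j) = #s * (u i * Real.log (u i)) -
        u i * ∑ j ∈ s, Real.log (u j) - (∑ j ∈ s, u j) * Real.log (u i) +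
          ∑ j ∈ s, u j * Real.log (u j) := by
      intro i _
      rw [mul_sum, sum_mul, ← nsmul_eq_mul, ← sum_const, ← sum_sub_distrib, ← sum_sub_distrib,
        ← sum_add_distrib]
      exact sum_congr rfl fun j _ => by unfold logGap; ring
    rw [sum_congr rfl this, sum_add_distrib, sum_sub_distrib, sum_sub_distrib, ← mul_sum,
      ← sum_mul, ← mul_sum, sum_const, nsmul_eq_mul]
    ring
  -- Jensen's inequality for the logarithm, as the log-sum inequality against the constant 1.
  have h2 : ∑ i ∈ s, Real.log (u i) ≤ #s * Real.log ((∑ i ∈ s, u i) / #s) := by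
    have := log_sum_le s (fun _ => (1 : ℝ)) u hs (by simp) hu
    simp only [sum_const, nsmul_eq_mul, mul_one, Real.log_one, one_mul, zero_sub,
      sum_neg_distrib] at this
    rw [Real.log_div hU.ne' hn.ne']
    linarith
  rw [h1]
  have h3 : 1 / (2 * (#s : ℝ)) * (2 * #s * ∑ i ∈ s, u i * Real.log (u i) -
        2 * ((∑ i ∈ s, u i) * ∑ i ∈ s, Real.log (u i))) = ∑ i ∈ s, u i * Real.log (u i) -
      (∑ i ∈ s, u i) * ((∑ i ∈ s, Real.log (u i)) / #s) := by
    field_simp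
  rw [h3]
  gcongr
  rw [div_le_iff₀ hn]
  linarith

/-- An off-diagonal pair `(j, k)` survives the erasure of every `i` other than `j` and `k`, hence
the factor `#S - 2`. -/
theorem sum_erase_erase {α : Type*} [DecidableEq α] (S : Finset α) (c : α → α → ℝ) (hc : ∀ j, c j j = 0) :
    ∑ i ∈ S, ∑ j ∈ S.erase i, ∑ k ∈ S.erase i, c j k =
      ((#S : ℝ) - 2) * ∑ j ∈ S, ∑ k ∈ S, c j k := by
  have h : ∀ i ∈ S, ∑ j ∈ S.erase i, ∑ k ∈ S.erase i, c j k =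
      ∑ j ∈ S, ∑ k ∈ S, c j k - ∑ j ∈ S, c j i - ∑ k ∈ S, c i k := by
    intro i hi
    simp_rw [sum_erase_eq_sub hi, sum_sub_distrib, hc]
    ring
  rw [sum_congr rfl h, sum_sub_distrib, sum_sub_distrib, sum_const, nsmul_eq_mul,
    sum_comm (f := fun i j => c j i)]
  ring

/-! ### Modified logarithmic Sobolev inequality for random transpositions. -/

section Perm

variable {α : Type*} [Fintype α] [DecidableEq α]

/-- The permutations that agree with `σ₀` outside `S`. -/
def agreeOff (S : Finset α) (σ₀ : Perm α) : Finset (Perm α) :=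
  univ.filter fun σ => ∀ x, x ∉ S → σ x = σ₀ x

theorem mem_agreeOff {S : Finset α} {σ₀ σ : Perm α} :
    σ ∈ agreeOff S σ₀ ↔ ∀ x, x ∉ S → σ x = σ₀ x := by simp [agreeOff]

theorem self_mem_agreeOff (S : Finset α) (σ₀ : Perm α) : σ₀ ∈ agreeOff S σ₀ := by
  simp [mem_agreeOff]

theorem agreeOff_empty (σ₀ : Perm α) : agreeOff ∅ σ₀ = {σ₀} := by
  ext σ
  simp [mem_agreeOff, Equiv.ext_iff]

theorem agreeOff_univ (σ₀ : Perm α) : agreeOff univ σ₀ = univ := by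
  ext σ
  simp [mem_agreeOff]

theorem mem_of_mem_agreeOff {S : Finset α} {σ₀ σ : Perm α} (h : σ ∈ agreeOff S σ₀) {i : α}
    (hi : i ∈ S) : σ₀⁻¹ (σ i) ∈ S := by
  by_contra hn
  have h1 := mem_agreeOff.1 h _ hn
  rw [← Perm.mul_apply σ₀, mul_inv_cancel, Perm.one_apply, EmbeddingLike.apply_eq_iff_eq] at h1
  exact hn (h1.symm ▸ hi : σ₀⁻¹ (σ i) ∈ S)

/-- Prescribing the value at one position leaves a class of the same shape with one free position
fewer; this self-similarity drives the induction. -/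
theorem mem_agreeOff_erase {S : Finset α} {σ₀ σ : Perm α} {i s : α} (hi : i ∈ S) (hs : s ∈ S) :
    σ ∈ agreeOff (S.erase i) (σ₀ * swap i s) ↔ σ ∈ agreeOff S σ₀ ∧ σ i = σ₀ s := by
  simp only [mem_agreeOff, mem_erase, Perm.mul_apply]
  constructor
  · intro h
    refine ⟨fun x hx => ?_, ?_⟩
    · rw [h x (fun h' => hx h'.2), swap_apply_of_ne_of_ne]
      · rintro rfl; exact hx hi
      · rintro rfl; exact hx hs
    · rw [h i (fun h' => h'.1 rfl), swap_apply_left]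
  · rintro ⟨h, h'⟩ x hx
    by_cases hxi : x = i
    · subst hxi
      rw [swap_apply_left, h']
    · have hxS : x ∉ S := fun hh => hx ⟨hxi, hh⟩
      rw [h x hxS, swap_apply_of_ne_of_ne hxi]
      rintro rfl
      exact hxS hs

theorem sum_agreeOff {S : Finset α} (σ₀ : Perm α) {i : α} (hi : i ∈ S) (F : Perm α → ℝ) :
    ∑ s ∈ S, ∑ σ ∈ agreeOff (S.erase i) (σ₀ * swap i s), F σ = ∑ σ ∈ agreeOff S σ₀, F σ := by
  rw [← sum_fiberwise_of_maps_to (t := S) (g := fun σ : Perm α => σ₀⁻¹ (σ i))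
    fun σ hσ => mem_of_mem_agreeOff hσ hi]
  refine sum_congr rfl fun s hs => sum_congr ?_ fun _ _ => rfl
  ext σ
  rw [mem_agreeOff_erase hi hs, mem_filter, Perm.inv_eq_iff_eq]

theorem swap_mul_mem_agreeOff {S : Finset α} {σ₀ σ : Perm α} {i s t : α} (hi : i ∈ S) (hs : s ∈ S)
    (ht : t ∈ S) (h : σ ∈ agreeOff (S.erase i) (σ₀ * swap i s)) :
    swap (σ₀ s) (σ₀ t) * σ ∈ agreeOff (S.erase i) (σ₀ * swap i t) := by
  rw [mem_agreeOff_erase hi hs] at h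
  rw [mem_agreeOff_erase hi ht, mem_agreeOff]
  refine ⟨fun x hx => ?_, by simp [h.2]⟩
  rw [Perm.mul_apply, mem_agreeOff.1 h.1 x hx, swap_apply_of_ne_of_ne]
  · simp only [ne_eq, EmbeddingLike.apply_eq_iff_eq]; rintro rfl; exact hx hs
  · simp only [ne_eq, EmbeddingLike.apply_eq_iff_eq]; rintro rfl; exact hx ht

theorem sum_agreeOff_swap {S : Finset α} (σ₀ : Perm α) {i s t : α} (hi : i ∈ S) (hs : s ∈ S)
    (ht : t ∈ S) (F : Perm α → ℝ) :
    ∑ σ ∈ agreeOff (S.erase i) (σ₀ * swap i s), F (swap (σ₀ s) (σ₀ t) * σ) =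
      ∑ σ ∈ agreeOff (S.erase i) (σ₀ * swap i t), F σ := by
  refine sum_nbij' (fun σ => swap (σ₀ s) (σ₀ t) * σ) (fun σ => swap (σ₀ t) (σ₀ s) * σ)
    (fun σ h => swap_mul_mem_agreeOff hi hs ht h) (fun σ h => swap_mul_mem_agreeOff hi ht hs h)
    ?_ ?_ ?_
  · intro σ _; rw [swap_comm (σ₀ t)]; simp [← mul_assoc]
  · intro σ _; rw [swap_comm (σ₀ t)]; simp [← mul_assoc]
  · simp

/-- Exchanging the value at `i` with `σ₀ t` is exchanging position `i` with the position `k`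
carrying `σ₀ t`, and `k` runs over `S` as `t` does. -/
theorem sum_swap_left_eq {S : Finset α} {σ₀ σ : Perm α} {i s : α} (hi : i ∈ S) (hs : s ∈ S)
    (h : σ ∈ agreeOff (S.erase i) (σ₀ * swap i s)) (F : Perm α → ℝ) :
    ∑ t ∈ S, F (swap (σ₀ s) (σ₀ t) * σ) = ∑ k ∈ S, F (σ * swap i k) := by
  rw [mem_agreeOff_erase hi hs] at h
  have hσ₀ : σ₀ ∈ agreeOff S σ := mem_agreeOff.2 fun x hx => (mem_agreeOff.1 h.1 x hx).symm
  refine sum_nbij' (fun t => σ⁻¹ (σ₀ t)) (fun k => σ₀⁻¹ (σ k))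
    (fun t ht => mem_of_mem_agreeOff hσ₀ ht) (fun k hk => mem_of_mem_agreeOff h.1 hk)
    (by simp) (by simp) ?_
  intro t _
  rw [Equiv.mul_swap_eq_swap_mul, h.2]
  simp

/-- The energy attached to the random transposition walk, restricted to positions in `S`. -/
noncomputable def logEnergy (S : Finset α) (σ₀ : Perm α) (f : Perm α → ℝ) (j k : α) : ℝ :=
  ∑ σ ∈ agreeOff S σ₀, logGap (f σ) (f (σ * swap j k))

theorem logEnergy_nonneg (S : Finset α) (σ₀ : Perm α) {f : Perm α → ℝ} (hf : ∀ σ, 0 < f σ)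
    (j k : α) : 0 ≤ logEnergy S σ₀ f j k :=
  sum_nonneg fun _ _ => logGap_nonneg (hf _) (hf _)

theorem logEnergy_self (S : Finset α) (σ₀ : Perm α) (f : Perm α → ℝ) (j : α) :
    logEnergy S σ₀ f j j = 0 := by
  simp [logEnergy, logGap_self, swap_self, ← Perm.one_def]

/-- This is the entropy carried by the value at `i`. The complete-graph inequality applies to the
fibre sums; transposing values matches any two fibres bijectively, and `logGap_sum_le` moves the gap
inside the sums. -/
theorem entropy_coarse_le {S : Finset α} (σ₀ : Perm α) {i : α} (hi : i ∈ S) {f : Perm α → ℝ}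
    (hf : ∀ σ, 0 < f σ) :
    ∑ s ∈ S, (∑ σ ∈ agreeOff (S.erase i) (σ₀ * swap i s), f σ) *
        Real.log (∑ σ ∈ agreeOff (S.erase i) (σ₀ * swap i s), f σ) -
      (∑ σ ∈ agreeOff S σ₀, f σ) * Real.log ((∑ σ ∈ agreeOff S σ₀, f σ) / #S) ≤
    1 / (2 * #S) * ∑ k ∈ S, logEnergy S σ₀ f i k := by
  have hpos : ∀ s ∈ S, 0 < ∑ σ ∈ agreeOff (S.erase i) (σ₀ * swap i s), f σ :=
    fun s _ => sum_pos (fun σ _ => hf σ) ⟨_, self_mem_agreeOff _ _⟩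
  have h := entropy_le_sum_logGap S _ ⟨i, hi⟩ hpos
  rw [sum_agreeOff σ₀ hi] at h
  refine h.trans (mul_le_mul_of_nonneg_left ?_ (by positivity))
  calc _ ≤ ∑ s ∈ S, ∑ t ∈ S, ∑ σ ∈ agreeOff (S.erase i) (σ₀ * swap i s),
          logGap (f σ) (f (swap (σ₀ s) (σ₀ t) * σ)) := by
        refine sum_le_sum fun s hs => sum_le_sum fun t ht => ?_
        rw [← sum_agreeOff_swap σ₀ hi hs ht f]
        exact logGap_sum_le _ _ _ ⟨_, self_mem_agreeOff _ _⟩ (fun σ _ => hf _) (fun σ _ => hf _)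
    _ = ∑ s ∈ S, ∑ σ ∈ agreeOff (S.erase i) (σ₀ * swap i s),
          ∑ k ∈ S, logGap (f σ) (f (σ * swap i k)) := by
        refine sum_congr rfl fun s hs => ?_
        rw [sum_comm]
        exact sum_congr rfl fun σ hσ => sum_swap_left_eq hi hs hσ fun τ => logGap (f σ) (f τ)
    _ = ∑ k ∈ S, logEnergy S σ₀ f i k := by
        rw [sum_agreeOff σ₀ hi, sum_comm]
        rfl

/-- The modified logarithmic Sobolev inequality for random transpositions. -/
theorem entropy_agreeOff_le (S : Finset α) (σ₀ : Perm α) {f : Perm α → ℝ} (hf : ∀ σ, 0 < f σ) :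
    ∑ σ ∈ agreeOff S σ₀, f σ * Real.log (f σ) -
      (∑ σ ∈ agreeOff S σ₀, f σ) * Real.log ((∑ σ ∈ agreeOff S σ₀, f σ) / (#S)!) ≤
    1 / (2 * #S) * ∑ j ∈ S, ∑ k ∈ S, logEnergy S σ₀ f j k := by
  induction hn : #S generalizing S σ₀ with
  | zero => simp [card_eq_zero.1 hn, agreeOff_empty]
  | succ n ih =>
    set E := ∑ σ ∈ agreeOff S σ₀, f σ * Real.log (f σ) -
      (∑ σ ∈ agreeOff S σ₀, f σ) * Real.log ((∑ σ ∈ agreeOff S σ₀, f σ) / (n + 1)!) with hE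
    set T := ∑ j ∈ S, ∑ k ∈ S, logEnergy S σ₀ f j k with hT
    have hT0 : 0 ≤ T := sum_nonneg fun j _ => sum_nonneg fun k _ => logEnergy_nonneg S σ₀ hf j k
    have hfac : (0 : ℝ) < (n ! : ℕ) := by exact_mod_cast n.factorial_pos
    have hX : 0 < ∑ σ ∈ agreeOff S σ₀, f σ := sum_pos (fun σ _ => hf σ) ⟨_, self_mem_agreeOff _ _⟩
    -- Chain rule: the entropy is that inside the fibres of the value at `i`, bounded by induction,
    -- plus that of the fibre sums.
    have step : ∀ i ∈ S, E ≤
        1 / (2 * n) * ∑ j ∈ S.erase i, ∑ k ∈ S.erase i, logEnergy S σ₀ f j k +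
          1 / (2 * (n + 1)) * ∑ k ∈ S, logEnergy S σ₀ f i k := by
      intro i hi
      have h1 := entropy_coarse_le σ₀ hi hf
      have h2 := sum_le_sum fun s (_ : s ∈ S) => ih (S.erase i) (σ₀ * swap i s)
        (by rw [card_erase_of_mem hi, hn]; rfl)
      have h3 : ∑ s ∈ S, 1 / (2 * (n : ℝ)) * ∑ j ∈ S.erase i, ∑ k ∈ S.erase i,
          logEnergy (S.erase i) (σ₀ * swap i s) f j k =
          1 / (2 * n) * ∑ j ∈ S.erase i, ∑ k ∈ S.erase i, logEnergy S σ₀ f j k := by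
        rw [← mul_sum, sum_comm]
        congr 1
        refine sum_congr rfl fun j _ => ?_
        rw [sum_comm]
        exact sum_congr rfl fun k _ => sum_agreeOff σ₀ hi _
      rw [h3, sum_sub_distrib, sum_agreeOff σ₀ hi] at h2
      have h4 : ∀ s ∈ S, (∑ σ ∈ agreeOff (S.erase i) (σ₀ * swap i s), f σ) *
          Real.log ((∑ σ ∈ agreeOff (S.erase i) (σ₀ * swap i s), f σ) / (n ! : ℕ)) =
          (∑ σ ∈ agreeOff (S.erase i) (σ₀ * swap i s), f σ) *
          Real.log (∑ σ ∈ agreeOff (S.erase i) (σ₀ * swap i s), f σ) -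
          (∑ σ ∈ agreeOff (S.erase i) (σ₀ * swap i s), f σ) * Real.log (n ! : ℕ) := by
        intro s _
        rw [Real.log_div (sum_pos (fun σ _ => hf σ) ⟨_, self_mem_agreeOff _ _⟩).ne' hfac.ne',
          mul_sub]
      rw [sum_congr rfl h4, sum_sub_distrib, ← sum_mul, sum_agreeOff σ₀ hi] at h2
      rw [hn, Real.log_div hX.ne' (by positivity)] at h1
      push_cast at h1
      rw [hE, Nat.factorial_succ, Real.log_div hX.ne' (by positivity)]
      push_cast
      rw [Real.log_mul (by positivity) hfac.ne']
      linarith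
    have h5 := sum_le_sum step
    rw [sum_const, nsmul_eq_mul, sum_add_distrib, ← mul_sum, ← mul_sum,
      sum_erase_erase S _ (logEnergy_self S σ₀ f), ← hT, hn] at h5
    push_cast at h5 ⊢
    have hn1 : (0 : ℝ) < n + 1 := by positivity
    -- After summing over `i`, the two sides differ by `T / (2 n (n + 1))`. For `n = 0` the
    -- convention `1 / 0 = 0` removes the first term and equality holds.
    have h6 : 1 / (2 * (n : ℝ)) * ((n + 1 - 2) * T) + 1 / (2 * (n + 1)) * T ≤
        (n + 1) * (1 / (2 * (n + 1)) * T) := by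
      rcases Nat.eq_zero_or_pos n with rfl | hp
      · simp
      · have hp' : (0 : ℝ) < n := by exact_mod_cast hp
        have : (n + 1) * (1 / (2 * ((n : ℝ) + 1)) * T) - (1 / (2 * (n : ℝ)) * ((n + 1 - 2) * T) +
            1 / (2 * (n + 1)) * T) = T / (2 * n * (n + 1)) := by
          field_simp
          ring
        have h7 : 0 ≤ T / (2 * n * (n + 1)) := by positivity
        linarith
    exact le_of_mul_le_mul_left (h5.trans h6) hn1

theorem entropy_perm_le {f : Perm α → ℝ} (hf : ∀ σ, 0 < f σ) :
    ∑ σ, f σ * Real.log (f σ) - (∑ σ, f σ) * Real.log ((∑ σ, f σ) / (Fintype.card α)!) ≤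
    1 / (2 * Fintype.card α) * ∑ σ, ∑ j, ∑ k, logGap (f σ) (f (σ * swap j k)) := by
  have h := entropy_agreeOff_le univ 1 hf
  simp only [logEnergy, agreeOff_univ, card_univ] at h
  refine h.trans (le_of_eq ?_)
  congr 1
  symm
  rw [sum_comm]
  exact sum_congr rfl fun j _ => sum_comm

end Perm

/-! ### Herbst's argument for self-bounding functions. -/

section Herbst

/-- The weight is taken at the point where the function is larger, since self-bounding controls only
decreases. For negative `l` this is the smaller exponential, and `exp (4 * |l|)` pays for the
exchange. -/
theorem logGap_exp_le_of_le {a b l : ℝ} (hab : b ≤ a) (h4 : a - b ≤ 4) :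
    logGap (Real.exp (l * a)) (Real.exp (l * b)) ≤
      l ^ 2 * Real.exp (4 * |l|) * ((a - b) ^ 2 * Real.exp (l * a)) := by
  unfold logGap
  rw [Real.log_exp, Real.log_exp]
  obtain ⟨d, hd⟩ : ∃ d, d = l * (a - b) := ⟨_, rfl⟩
  have hb : l * b = l * a - d := by rw [hd]; ring
  have hd4 : -d ≤ 4 * |l| := by
    calc -d ≤ |d| := neg_le_abs d
      _ = |l| * (a - b) := by rw [hd, abs_mul, abs_of_nonneg (sub_nonneg.2 hab)]
      _ ≤ 4 * |l| := by nlinarith [abs_nonneg l]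
  have key : d * (1 - Real.exp (-d)) ≤ d ^ 2 * Real.exp (4 * |l|) := by
    have h1 : 1 - Real.exp (-d) ≤ d := by linarith [Real.add_one_le_exp (-d)]
    rcases le_total 0 d with h0 | h0
    · calc d * (1 - Real.exp (-d)) ≤ d ^ 2 * 1 := by nlinarith
        _ ≤ _ := by
          gcongr
          exact Real.one_le_exp (by positivity)
    · have h2 : Real.exp (-d) - 1 ≤ -d * Real.exp (-d) := by
        have := mul_le_mul_of_nonneg_right (Real.add_one_le_exp d) (Real.exp_pos (-d)).le
        rw [← Real.exp_add, add_neg_cancel, Real.exp_zero] at this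
        linarith
      calc d * (1 - Real.exp (-d)) ≤ d ^ 2 * Real.exp (-d) := by nlinarith
        _ ≤ _ := by gcongr
  have h5 : (Real.exp (l * a) - Real.exp (l * b)) * (l * a - l * b) =
      Real.exp (l * a) * (d * (1 - Real.exp (-d))) := by
    rw [hb, sub_eq_add_neg (l * a) d, Real.exp_add]
    ring
  rw [h5]
  calc _ ≤ Real.exp (l * a) * (d ^ 2 * Real.exp (4 * |l|)) := by gcongr
    _ = _ := by rw [hd]; ring

theorem logGap_exp_le {a b l : ℝ} (hab : a - b ≤ 4) (hba : b - a ≤ 4) :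
    logGap (Real.exp (l * a)) (Real.exp (l * b)) ≤
      l ^ 2 * Real.exp (4 * |l|) *
        (max (a - b) 0 ^ 2 * Real.exp (l * a) + max (b - a) 0 ^ 2 * Real.exp (l * b)) := by
  rcases le_total b a with h | h
  · rw [max_eq_left (sub_nonneg.2 h), max_eq_right (sub_nonpos.2 h)]
    simpa using logGap_exp_le_of_le h hab
  · rw [max_eq_right (sub_nonpos.2 h), max_eq_left (sub_nonneg.2 h)]
    have := logGap_exp_le_of_le (l := l) h hba
    have h2 : logGap (Real.exp (l * a)) (Real.exp (l * b)) =
      logGap (Real.exp (l * b)) (Real.exp (l * a)) := by unfold logGap; ring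
    simpa [h2] using this

/-- Entropy bound for exponentials of a weakly self-bounding function of a permutation. -/
theorem entropy_exp_le_of_selfBounding {α : Type*} [Fintype α] [DecidableEq α]
    {h : Perm α → ℝ} (h4 : ∀ σ j k, h σ - h (σ * swap j k) ≤ 4)
    (hself : ∀ σ, ∑ j, ∑ k, max (h σ - h (σ * swap j k)) 0 ^ 2 ≤ 8 * Fintype.card α * h σ)
    (h0 : ∀ σ, 0 ≤ h σ) (l : ℝ) :
    ∑ σ, Real.exp (l * h σ) * (l * h σ) - (∑ σ, Real.exp (l * h σ)) *
        Real.log ((∑ σ, Real.exp (l * h σ)) / (Fintype.card α)!) ≤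
      8 * Real.exp (4 * |l|) * l ^ 2 * ∑ σ, h σ * Real.exp (l * h σ) := by
  have hent := entropy_perm_le (f := fun σ => Real.exp (l * h σ)) fun σ => Real.exp_pos _
  simp only [Real.log_exp] at hent
  refine hent.trans ?_
  set c := l ^ 2 * Real.exp (4 * |l|) with hc
  have hc0 : 0 ≤ c := by positivity
  -- Reversing a transposition turns increases into decreases, so both halves of the energy agree.
  have hsymm : ∀ j k : α, ∑ σ, max (h (σ * swap j k) - h σ) 0 ^ 2 * Real.exp (l * h (σ * swap j k))
      = ∑ σ, max (h σ - h (σ * swap j k)) 0 ^ 2 * Real.exp (l * h σ) := by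
    intro j k
    refine Fintype.sum_equiv (Equiv.mulRight (swap j k)) _ _ fun σ => ?_
    simp [mul_assoc]
  have hle : ∑ σ, ∑ j, ∑ k, logGap (Real.exp (l * h σ)) (Real.exp (l * h (σ * swap j k))) ≤
      c * (2 * ∑ σ, (∑ j, ∑ k, max (h σ - h (σ * swap j k)) 0 ^ 2) * Real.exp (l * h σ)) := by
    calc _ ≤ ∑ σ, ∑ j, ∑ k, c * (max (h σ - h (σ * swap j k)) 0 ^ 2 * Real.exp (l * h σ) +
          max (h (σ * swap j k) - h σ) 0 ^ 2 * Real.exp (l * h (σ * swap j k))) := by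
          refine sum_le_sum fun σ _ => sum_le_sum fun j _ => sum_le_sum fun k _ => ?_
          refine logGap_exp_le (h4 _ _ _) ?_
          simpa [mul_assoc] using h4 (σ * swap j k) j k
      _ = c * (2 * ∑ j, ∑ k, ∑ σ, max (h σ - h (σ * swap j k)) 0 ^ 2 * Real.exp (l * h σ)) := by
          rw [sum_comm]
          simp_rw [sum_comm (s := (univ : Finset (Perm α))), ← mul_sum, sum_add_distrib, hsymm]
          ring
      _ = _ := by
          simp_rw [sum_mul]
          rw [sum_comm (s := (univ : Finset (Perm α)))]
          simp_rw [sum_comm (s := (univ : Finset (Perm α)))]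
  have hle2 : ∑ σ, (∑ j, ∑ k, max (h σ - h (σ * swap j k)) 0 ^ 2) * Real.exp (l * h σ) ≤
      8 * Fintype.card α * ∑ σ, h σ * Real.exp (l * h σ) := by
    rw [mul_sum]
    refine sum_le_sum fun σ _ => ?_
    rw [← mul_assoc]
    exact mul_le_mul_of_nonneg_right (hself σ) (Real.exp_pos _).le
  have hS : 0 ≤ ∑ σ, h σ * Real.exp (l * h σ) :=
    sum_nonneg fun σ _ => mul_nonneg (h0 σ) (Real.exp_pos _).le
  set S := ∑ σ, h σ * Real.exp (l * h σ)
  calc _ ≤ 1 / (2 * (Fintype.card α : ℝ)) * (c * (2 * (8 * Fintype.card α * S))) := by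
        gcongr
        exact hle.trans (by gcongr)
    _ = 8 * c * S * ((Fintype.card α : ℝ) / Fintype.card α) := by ring
    _ ≤ 8 * c * S * 1 := by
        gcongr
        exact div_self_le_one _
    _ = _ := by rw [hc]; ring

/-- Herbst's argument for a function `G` with `l G' - G ≤ c l² G'`. -/
theorem herbst_ode {G G' : ℝ → ℝ} (hG : ∀ l, HasDerivAt G (G' l) l) (hG0 : G 0 = 0) {c d : ℝ}
    (hd : 0 < d) (h : ∀ l, |l| ≤ d → l * G' l - G l ≤ c * l ^ 2 * G' l) :
    G d * (1 - c * d) + G (-d) * (1 + c * d) ≤ 0 := by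
  -- The derivative of `G l / l * (1 - c * l)` is `(l G' - G - c l² G') / l²`, nonpositive by
  -- hypothesis. `dslope` fills in the value at 0, so monotonicity passes through the origin and
  -- compares `-d` with `d`.
  set u : ℝ → ℝ := fun l => dslope G 0 l * (1 - c * l) with hu
  have hslope : ∀ l, l ≠ 0 → u l = G l / l * (1 - c * l) := by
    intro l hl
    simp [hu, dslope_of_ne _ hl, slope_def_field, hG0]
  have hcont : Continuous u := by
    refine Continuous.mul ?_ (by fun_prop)
    rw [continuous_iff_continuousAt]
    intro l
    rcases eq_or_ne l 0 with rfl | hl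
    · exact continuousAt_dslope_same.2 (hG 0).differentiableAt
    · exact (continuousAt_dslope_of_ne hl).2 (hG l).continuousAt
  have hder : ∀ l, l ≠ 0 → HasDerivAt u
      ((l * G' l - G l - c * l ^ 2 * G' l) / l ^ 2) l := by
    intro l hl
    have h1 : HasDerivAt (fun l => G l / l * (1 - c * l)) _ l :=
      ((hG l).div (hasDerivAt_id l) hl).mul (((hasDerivAt_id l).const_mul c).const_sub 1)
    refine (h1.congr_of_eventuallyEq ?_).congr_deriv ?_
    · filter_upwards [isOpen_ne.mem_nhds hl] with y hy using hslope y hy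
    · simp only [id, Pi.div_apply]
      field_simp
      ring
  have hneg : ∀ l, l ≠ 0 → |l| ≤ d → deriv u l ≤ 0 := by
    intro l hl hld
    rw [(hder l hl).deriv]
    exact div_nonpos_of_nonpos_of_nonneg (by linarith [h l hld]) (sq_nonneg l)
  have h1 : AntitoneOn u (Set.Icc 0 d) := by
    refine antitoneOn_of_deriv_nonpos (convex_Icc _ _) hcont.continuousOn ?_ ?_
    · rw [interior_Icc]
      exact fun l hl => (hder l hl.1.ne').differentiableAt.differentiableWithinAt
    · rw [interior_Icc]
      exact fun l hl => hneg l hl.1.ne' (abs_le.2 ⟨by linarith [hl.1], hl.2.le⟩)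
  have h2 : AntitoneOn u (Set.Icc (-d) 0) := by
    refine antitoneOn_of_deriv_nonpos (convex_Icc _ _) hcont.continuousOn ?_ ?_
    · rw [interior_Icc]
      exact fun l hl => (hder l hl.2.ne).differentiableAt.differentiableWithinAt
    · rw [interior_Icc]
      exact fun l hl => hneg l hl.2.ne (abs_le.2 ⟨hl.1.le, by linarith [hl.2]⟩)
  have h3 := (h1 (Set.left_mem_Icc.2 hd.le) (Set.right_mem_Icc.2 hd.le) hd.le).trans
    (h2 (Set.left_mem_Icc.2 (by linarith)) (Set.right_mem_Icc.2 (by linarith)) (by linarith))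
  rw [hslope d hd.ne', hslope (-d) (by linarith)] at h3
  have h4 := mul_le_mul_of_nonneg_right h3 hd.le
  have e1 : G d / d * (1 - c * d) * d = G d * (1 - c * d) := by field_simp
  have e2 : G (-d) / -d * (1 - c * -d) * d = -(G (-d) * (1 + c * d)) := by field_simp; ring
  linarith

/-- Here `G` is the logarithm of the mean of `exp (l * h)`. With `c = 10` and `d = 1 / 30` the
weights in `herbst_ode` are `2 / 3` and `4 / 3`, whence the exponents 1 and 2. -/
theorem exp_mul_exp_neg_sq_le {Ω : Type*} [Fintype Ω] [Nonempty Ω] {h : Ω → ℝ}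
    (hent : ∀ l : ℝ, |l| ≤ 1 / 30 → ∑ σ, Real.exp (l * h σ) * (l * h σ) -
      (∑ σ, Real.exp (l * h σ)) * Real.log ((∑ σ, Real.exp (l * h σ)) / Fintype.card Ω) ≤
      10 * l ^ 2 * ∑ σ, h σ * Real.exp (l * h σ)) :
    (∑ σ, Real.exp (1 / 30 * h σ)) * (∑ σ, Real.exp (-(1 / 30) * h σ)) ^ 2 ≤
      (Fintype.card Ω : ℝ) ^ 3 := by
  have hN : (0 : ℝ) < Fintype.card Ω := by exact_mod_cast Fintype.card_pos
  have hM : ∀ l : ℝ, 0 < ∑ σ, Real.exp (l * h σ) :=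
    fun l => sum_pos (fun _ _ => Real.exp_pos _) univ_nonempty
  have hder : ∀ l : ℝ, HasDerivAt
      (fun l => Real.log ((∑ σ, Real.exp (l * h σ)) / Fintype.card Ω))
      ((∑ σ, h σ * Real.exp (l * h σ)) / ∑ σ, Real.exp (l * h σ)) l := by
    intro l
    have h1 : HasDerivAt (fun l => ∑ σ, Real.exp (l * h σ)) (∑ σ, h σ * Real.exp (l * h σ)) l := by
      refine HasDerivAt.fun_sum fun σ _ => ?_
      have := ((hasDerivAt_id l).mul_const (h σ)).exp
      simpa [mul_comm] using this
    refine ((h1.div_const _).log (div_pos (hM l) hN).ne').congr_deriv ?_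
    rw [div_div_div_cancel_right₀ hN.ne']
  have hode := herbst_ode hder (by simp [hN.ne']) (c := 10) (d := 1 / 30) (by norm_num) (by
    intro l hl
    have h1 := hent l hl
    have h2 := div_le_div_of_nonneg_right h1 (hM l).le
    have h3 : ∑ σ, Real.exp (l * h σ) * (l * h σ) = l * ∑ σ, h σ * Real.exp (l * h σ) := by
      rw [mul_sum]
      exact sum_congr rfl fun _ _ => by ring
    rw [h3, sub_div, mul_div_cancel_left₀ _ (hM l).ne', mul_div_assoc, mul_div_assoc] at h2
    exact h2)
  have hA := hM (1 / 30)
  have hB := hM (-(1 / 30))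
  rw [Real.log_div hA.ne' hN.ne', Real.log_div hB.ne' hN.ne'] at hode
  rw [← Real.log_le_log_iff (by positivity) (by positivity), Real.log_mul hA.ne' (by positivity),
    Real.log_pow, Real.log_pow]
  push_cast
  linarith

theorem exp_mul_card_sq_le_of_selfBounding {α : Type*} [Fintype α] [DecidableEq α]
    {h : Perm α → ℝ} (h4 : ∀ σ j k, h σ - h (σ * swap j k) ≤ 4)
    (hself : ∀ σ, ∑ j, ∑ k, max (h σ - h (σ * swap j k)) 0 ^ 2 ≤ 8 * Fintype.card α * h σ)
    (h0 : ∀ σ, 0 ≤ h σ) (A : Finset (Perm α)) (hA : ∀ σ ∈ A, h σ = 0) :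
    (∑ σ, Real.exp (1 / 30 * h σ)) * (#A : ℝ) ^ 2 ≤ (Fintype.card (Perm α) : ℝ) ^ 3 := by
  refine le_trans ?_ (exp_mul_exp_neg_sq_le (h := h) fun l hl => ?_)
  · have : (#A : ℝ) ≤ ∑ σ, Real.exp (-(1 / 30) * h σ) := by
      calc (#A : ℝ) = ∑ σ ∈ A, Real.exp (-(1 / 30) * h σ) := by
            rw [sum_congr rfl fun σ hσ => by rw [hA σ hσ, mul_zero, Real.exp_zero]]
            simp
        _ ≤ _ := sum_le_univ_sum_of_nonneg fun σ => (Real.exp_pos _).le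
    gcongr
  · rw [Fintype.card_perm]
    refine (entropy_exp_le_of_selfBounding h4 hself h0 l).trans ?_
    have hS : 0 ≤ ∑ σ, h σ * Real.exp (l * h σ) :=
      sum_nonneg fun σ _ => mul_nonneg (h0 σ) (Real.exp_pos _).le
    -- The range `|l| ≤ 1 / 30` is small enough that `8 * exp (4 * |l|) ≤ 10`.
    have he : Real.exp (4 * |l|) ≤ 10 / 8 := by
      have h1 : Real.exp (4 * |l|) ≤ Real.exp (2 / 15) := by gcongr; linarith
      have h2 := Real.add_one_le_exp (-(2 / 15 : ℝ))
      have h3 : Real.exp (2 / 15) * Real.exp (-(2 / 15)) = 1 := by rw [← Real.exp_add]; simp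
      nlinarith [Real.exp_pos (2 / 15)]
    gcongr
    linarith

end Herbst

/-! ### Convex distance inequality for permuted vectors. -/

section ConvexDistance

/-- With `p` the projection of `x`, `2 (x - p)` is a subgradient of the squared distance. The
projection `q` of `y` makes an obtuse angle at `p`, and a square is dropped from the expansion of
`‖y - q‖ ^ 2`. -/
theorem exists_infDist_sq_sub_le {E : Type*} [NormedAddCommGroup E] [InnerProductSpace ℝ E]
    [ProperSpace E] {K : Set E} (hK : Convex ℝ K) (hc : IsClosed K) (hne : K.Nonempty) (x : E) :
    ∃ p ∈ K, Metric.infDist x K = ‖x - p‖ ∧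
      ∀ y, Metric.infDist x K ^ 2 - Metric.infDist y K ^ 2 ≤ 2 * inner ℝ (x - p) (x - y) := by
  obtain ⟨p, hp, hxp⟩ := hc.exists_infDist_eq_dist hne x
  rw [dist_eq_norm] at hxp
  refine ⟨p, hp, hxp, fun y => ?_⟩
  obtain ⟨q, hq, hyq⟩ := hc.exists_infDist_eq_dist hne y
  rw [dist_eq_norm] at hyq
  have hinner : inner ℝ (x - p) (q - p) ≤ 0 := by
    refine (norm_eq_iInf_iff_real_inner_le_zero hK hp).1 ?_ q hq
    rw [← hxp, Metric.infDist_eq_iInf]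
    simp [dist_eq_norm]
  rw [hxp, hyq]
  have h1 : y - q = (x - p) - ((x - y) + (q - p)) := by abel
  have h2 := norm_sub_sq_real (x - p) ((x - y) + (q - p))
  rw [inner_add_right] at h2
  rw [h1, h2]
  nlinarith [sq_nonneg ‖(x - y) + (q - p)‖]

variable {n : ℕ}

theorem permutedVector_mem_unitCube {x : Fin n → ℝ} (hx : ∀ i, x i ∈ Set.Icc (0 : ℝ) 1)
    (σ : Perm (Fin n)) : permutedVector x σ ∈ unitCube n := fun i => hx (σ i)

theorem inner_sub_permutedVector_swap (x : Fin n → ℝ) (u : EuclideanSpace ℝ (Fin n))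
    (σ : Perm (Fin n)) (j k : Fin n) :
    inner ℝ u (permutedVector x σ - permutedVector x (σ * swap j k)) =
      (u j - u k) * (x (σ j) - x (σ k)) := by
  rw [PiLp.inner_apply]
  simp only [permutedVector, PiLp.sub_apply, Perm.mul_apply, RCLike.inner_apply, conj_trivial]
  rcases eq_or_ne j k with rfl | hjk
  · simp
  · rw [sum_eq_add j k hjk]
    · rw [swap_apply_left, swap_apply_right]
      ring
    · rintro c - ⟨h1, h2⟩
      rw [swap_apply_of_ne_of_ne h1 h2]
      ring
    · simp
    · simp

theorem sum_sum_sub_sq_le (u : Fin n → ℝ) :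
    ∑ j, ∑ k, (u j - u k) ^ 2 ≤ 2 * n * ∑ j, u j ^ 2 := by
  have h : ∑ j, ∑ k, (u j - u k) ^ 2 = 2 * n * ∑ j, u j ^ 2 - 2 * (∑ j, u j) ^ 2 := by
    have h1 : ∀ j, ∑ k, (u j - u k) ^ 2 = n * u j ^ 2 - 2 * u j * ∑ k, u k + ∑ k, u k ^ 2 := by
      intro j
      simp_rw [sub_sq, sum_add_distrib, sum_sub_distrib, mul_sum]
      simp
    simp_rw [h1, sum_add_distrib, sum_sub_distrib, ← sum_mul, ← mul_sum]
    simp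
    ring
  rw [h]
  linarith [sq_nonneg (∑ j, u j)]

theorem isClosed_unitCube (n : ℕ) : IsClosed (unitCube n) := by
  have : unitCube n = ⋂ i, {v : EuclideanSpace ℝ (Fin n) | v i ∈ Set.Icc (0 : ℝ) 1} := by
    ext v
    simp [unitCube]
  rw [this]
  exact isClosed_iInter fun i => isClosed_Icc.preimage (by fun_prop)

/-- Talagrand's convex distance inequality on the symmetric group, for Euclidean distances. -/
theorem exp_infDist_sq_mul_card_sq_le {x : Fin n → ℝ} (hx : ∀ i, x i ∈ Set.Icc (0 : ℝ) 1)
    {K : Set (EuclideanSpace ℝ (Fin n))} (hK : Convex ℝ K) (hc : IsClosed K)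
    (hKn : K ⊆ unitCube n) (hne : K.Nonempty) (A : Finset (Perm (Fin n)))
    (hA : ∀ σ ∈ A, permutedVector x σ ∈ K) :
    (∑ σ, Real.exp (1 / 30 * Metric.infDist (permutedVector x σ) K ^ 2)) * (#A : ℝ) ^ 2 ≤
      (Fintype.card (Perm (Fin n)) : ℝ) ^ 3 := by
  -- Here `u` is the vector to the projection, with entries in `[-1, 1]` because both ends lie in
  -- the cube. A transposition moves only two coordinates, each by at most 1.
  have hdiff : ∀ σ : Perm (Fin n), ∃ u : Fin n → ℝ, (∀ j, |u j| ≤ 1) ∧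
      Metric.infDist (permutedVector x σ) K ^ 2 = ∑ j, u j ^ 2 ∧
      ∀ j k, Metric.infDist (permutedVector x σ) K ^ 2 -
        Metric.infDist (permutedVector x (σ * swap j k)) K ^ 2 ≤ 2 * |u j - u k| := by
    intro σ
    obtain ⟨p, hp, h1, h2⟩ := exists_infDist_sq_sub_le hK hc hne (permutedVector x σ)
    refine ⟨fun j => (permutedVector x σ - p) j, fun j => ?_, ?_, fun j k => ?_⟩
    · have h3 := permutedVector_mem_unitCube hx σ j
      have h4 := hKn hp j
      simp only [PiLp.sub_apply, abs_le]
      constructor <;> linarith [h3.1, h3.2, h4.1, h4.2]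
    · rw [h1, EuclideanSpace.norm_sq_eq]
      simp
    · refine (h2 _).trans ?_
      rw [inner_sub_permutedVector_swap]
      have h3 : |x (σ j) - x (σ k)| ≤ 1 := by
        rw [abs_le]
        constructor <;> linarith [(hx (σ j)).1, (hx (σ j)).2, (hx (σ k)).1, (hx (σ k)).2]
      refine mul_le_mul_of_nonneg_left ((le_abs_self _).trans ?_) zero_le_two
      rw [abs_mul]
      exact mul_le_of_le_one_right (abs_nonneg _) h3
  refine exp_mul_card_sq_le_of_selfBounding (fun σ j k => ?_) (fun σ => ?_)
    (fun σ => sq_nonneg _) A fun σ hσ => ?_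
  · obtain ⟨u, hu, -, h⟩ := hdiff σ
    refine (h j k).trans ?_
    linarith [abs_sub (u j) (u k), hu j, hu k]
  · obtain ⟨u, -, hu, h⟩ := hdiff σ
    rw [hu, Fintype.card_fin]
    calc _ ≤ ∑ j, ∑ k, 4 * (u j - u k) ^ 2 := by
          refine sum_le_sum fun j _ => sum_le_sum fun k _ => ?_
          rw [← hu, show 4 * (u j - u k) ^ 2 = (2 * |u j - u k|) ^ 2 by rw [mul_pow, sq_abs]; norm_num]
          gcongr
          exact max_le (h j k) (by positivity)
      _ = 4 * ∑ j, ∑ k, (u j - u k) ^ 2 := by simp_rw [mul_sum]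
      _ ≤ 4 * (2 * n * ∑ j, u j ^ 2) := by gcongr; exact sum_sum_sub_sq_le u
      _ = _ := by ring
  · rw [Metric.infDist_zero_of_mem (hA σ hσ)]
    norm_num

end ConvexDistance

/-! ### Concentration and moments around a median. -/

section Concentration

/-- The average of the inverse square roots of the ranks is at most `2`. -/
theorem sum_inv_sqrt_card_le {ι : Type*} [DecidableEq ι] (w : ι → ℝ) (s : Finset ι) :
    ∑ i ∈ s, (√(#(s.filter fun j => w i ≤ w j)))⁻¹ ≤ 2 * √(#s) := by
  induction s using Finset.induction_on_min_value w with
  | empty => simp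
  | insert a s ha hmin ih =>
    rw [sum_insert ha, card_insert_of_notMem ha]
    have h1 : #((insert a s).filter fun j => w a ≤ w j) = #s + 1 := by
      rw [filter_true_of_mem, card_insert_of_notMem ha]
      intro j hj
      rcases mem_insert.1 hj with rfl | hj
      · exact le_rfl
      · exact hmin j hj
    have h2 : ∑ i ∈ s, (√(#((insert a s).filter fun j => w i ≤ w j)))⁻¹ ≤
        ∑ i ∈ s, (√(#(s.filter fun j => w i ≤ w j)))⁻¹ := by
      refine sum_le_sum fun i hi => ?_
      have hpos : 0 < #(s.filter fun j => w i ≤ w j) :=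
        card_pos.2 ⟨i, mem_filter.2 ⟨hi, le_rfl⟩⟩
      gcongr
      exact subset_insert a s
    rw [h1]
    push_cast
    have hm : (0 : ℝ) ≤ #s := by positivity
    -- Telescoping bound: the new minimum has count `#s + 1`, and the other counts can only grow.
    have h3 : (√((#s : ℝ) + 1))⁻¹ ≤ 2 * √((#s : ℝ) + 1) - 2 * √(#s) := by
      have hp : 0 < √((#s : ℝ) + 1) := by positivity
      rw [inv_le_iff_one_le_mul₀ hp]
      have e1 := Real.sq_sqrt hm
      have e2 := Real.sq_sqrt (by linarith : (0 : ℝ) ≤ (#s : ℝ) + 1)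
      nlinarith [sq_nonneg (√((#s : ℝ) + 1) - √(#s))]
    linarith

/-- Existence of a median. -/
theorem exists_median {Ω : Type*} [Fintype Ω] [Nonempty Ω] (f : Ω → ℝ) :
    ∃ m, Fintype.card Ω ≤ 2 * #(univ.filter fun σ => f σ ≤ m) ∧
      Fintype.card Ω ≤ 2 * #(univ.filter fun σ => m ≤ f σ) := by
  classical
  obtain ⟨τ, -, hτ⟩ := exists_max_image univ f univ_nonempty
  -- The median is the least value whose sublevel set holds half of the points. Were fewer than half
  -- at or above it, the next smaller value would qualify too.
  obtain ⟨σ₀, h0, hmin⟩ := exists_min_image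
    (univ.filter fun σ => Fintype.card Ω ≤ 2 * #(univ.filter fun ρ => f ρ ≤ f σ)) f
    ⟨τ, mem_filter.2 ⟨mem_univ _, by
      rw [filter_true_of_mem fun ρ _ => hτ ρ (mem_univ _), card_univ]; omega⟩⟩
  refine ⟨f σ₀, (mem_filter.1 h0).2, ?_⟩
  by_contra! hlt
  have hadd := card_filter_add_card_filter_not (s := (univ : Finset Ω)) fun σ => f σ₀ ≤ f σ
  rw [card_univ] at hadd
  obtain ⟨ρ, hρ, hmax⟩ := exists_max_image (univ.filter fun σ => ¬ f σ₀ ≤ f σ) f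
    (card_pos.1 (by omega))
  have hle : #(univ.filter fun σ => ¬ f σ₀ ≤ f σ) ≤ #(univ.filter fun σ => f σ ≤ f ρ) :=
    card_le_card fun σ hσ => mem_filter.2 ⟨mem_univ _, hmax σ hσ⟩
  have := hmin ρ (mem_filter.2 ⟨mem_univ _, by omega⟩)
  exact (mem_filter.1 hρ).2 this

variable {n : ℕ}

/-- A nearest point of the sublevel set has value at most `a`, so the Lipschitz bound makes the
excess over `a` at most `L` times the distance. -/
theorem exp_max_sub_sq_mul_card_sq_le {x : Fin n → ℝ} (hx : ∀ i, x i ∈ Set.Icc (0 : ℝ) 1)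
    {L : ℝ≥0} (hL : 0 < L) {f : EuclideanSpace ℝ (Fin n) → ℝ}
    (hf : LipschitzOnWith L f (unitCube n)) (hconv : ConvexOn ℝ (unitCube n) f) (a : ℝ)
    (hne : ∃ σ, f (permutedVector x σ) ≤ a) :
    (∑ σ, Real.exp (1 / 30 * (max (f (permutedVector x σ) - a) 0 / L) ^ 2)) *
      (#(univ.filter fun σ => f (permutedVector x σ) ≤ a) : ℝ) ^ 2 ≤
      (Fintype.card (Perm (Fin n)) : ℝ) ^ 3 := by
  have hL' : (0 : ℝ) < L := hL
  set K := {v ∈ unitCube n | f v ≤ a} with hKd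
  have hc : IsClosed K :=
    hf.continuousOn.preimage_isClosed_of_isClosed (isClosed_unitCube n) isClosed_Iic
  have hneK : K.Nonempty :=
    hne.imp' (permutedVector x) fun σ hσ => ⟨permutedVector_mem_unitCube hx σ, hσ⟩
  refine le_trans ?_ (exp_infDist_sq_mul_card_sq_le hx (hconv.convex_le a) hc
    (fun v hv => hv.1) hneK (univ.filter fun σ => f (permutedVector x σ) ≤ a)
    fun σ hσ => ⟨permutedVector_mem_unitCube hx σ, (mem_filter.1 hσ).2⟩)
  gcongr with σ _
  obtain ⟨p, hp, hxp⟩ := hc.exists_infDist_eq_dist hneK (permutedVector x σ)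
  have h1 := hf.dist_le_mul _ (permutedVector_mem_unitCube hx σ) p hp.1
  rw [Real.dist_eq] at h1
  rw [div_le_iff₀ hL', hxp, mul_comm]
  refine max_le ?_ (by positivity)
  linarith [le_abs_self (f (permutedVector x σ) - f p), hp.2]

/-- Subgaussian concentration around a median. -/
theorem exists_sum_exp_sq_le {x : Fin n → ℝ} (hx : ∀ i, x i ∈ Set.Icc (0 : ℝ) 1)
    {L : ℝ≥0} (hL : 0 < L) {f : EuclideanSpace ℝ (Fin n) → ℝ}
    (hf : LipschitzOnWith L f (unitCube n)) (hconv : ConvexOn ℝ (unitCube n) f) :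
    ∃ m, ∑ σ, Real.exp (1 / 120 * ((f (permutedVector x σ) - m) / L) ^ 2) ≤
      8 * Fintype.card (Perm (Fin n)) := by
  have hL' : (0 : ℝ) < L := hL
  set g : Perm (Fin n) → ℝ := fun σ => f (permutedVector x σ) with hg
  set N : ℝ := ((Fintype.card (Perm (Fin n)) : ℕ) : ℝ) with hN
  have hN0 : 0 < N := by rw [hN]; exact_mod_cast Fintype.card_pos
  obtain ⟨m, hm1, hm2⟩ := exists_median g
  have hm1' : N ≤ 2 * #(univ.filter fun σ => g σ ≤ m) := by rw [hN]; exact_mod_cast hm1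
  have hm2' : N ≤ 2 * #(univ.filter fun σ => m ≤ g σ) := by rw [hN]; exact_mod_cast hm2
  refine ⟨m, ?_⟩
  have hupper : ∑ σ, Real.exp (1 / 30 * (max (g σ - m) 0 / L) ^ 2) ≤ 4 * N := by
    have hne : ∃ σ, g σ ≤ m := by
      by_contra! h
      rw [filter_false_of_mem fun σ _ => not_le.2 (h σ)] at hm1'
      simp at hm1'
      linarith
    have h1 := exp_max_sub_sq_mul_card_sq_le hx hL hf hconv m hne
    have h2 : N ^ 2 ≤ 4 * (#(univ.filter fun σ => g σ ≤ m) : ℝ) ^ 2 := by nlinarith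
    have h0 : 0 ≤ ∑ σ, Real.exp (1 / 30 * (max (g σ - m) 0 / L) ^ 2) :=
      sum_nonneg fun _ _ => (Real.exp_pos _).le
    have h3 := mul_le_mul_of_nonneg_left h2 h0
    have h4 : (∑ σ, Real.exp (1 / 30 * (max (g σ - m) 0 / L) ^ 2)) * N ^ 2 ≤ 4 * N * N ^ 2 := by
      linarith
    exact le_of_mul_le_mul_right h4 (by positivity)
  -- The level is `g σ` itself: at least half of the points exceed it by `m - g σ` or more, and its
  -- sublevel set has `r` elements, the rank of `σ`. Passing from `1 / 30` to `1 / 120` takes a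
  -- fourth root, leaving the summable order `√(N / r)`.
  have hlower1 : ∀ σ, g σ < m → Real.exp (1 / 120 * ((g σ - m) / L) ^ 2) ≤
      2 * √N * (√(#(univ.filter fun τ => -g σ ≤ -g τ)))⁻¹ := by
    intro σ hσ
    simp only [neg_le_neg_iff]
    have hr : (0 : ℝ) < #(univ.filter fun τ => g τ ≤ g σ) := by
      exact Nat.cast_pos.2 (card_pos.2 ⟨σ, mem_filter.2 ⟨mem_univ _, le_rfl⟩⟩)
    set r : ℝ := ((#(univ.filter fun τ => g τ ≤ g σ) : ℕ) : ℝ)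
    have h1 := exp_max_sub_sq_mul_card_sq_le hx hL hf hconv (g σ) ⟨σ, le_rfl⟩
    set e := Real.exp (1 / 120 * ((g σ - m) / L) ^ 2) with he
    have he0 : 0 < e := Real.exp_pos _
    have h2 : #(univ.filter fun τ => m ≤ g τ) * e ^ 4 ≤
        ∑ τ, Real.exp (1 / 30 * (max (g τ - g σ) 0 / L) ^ 2) := by
      have he4 : e ^ 4 = Real.exp (1 / 30 * ((m - g σ) / L) ^ 2) := by
        rw [he, ← Real.exp_nat_mul]
        congr 1
        push_cast
        ring
      rw [← nsmul_eq_mul, ← sum_const, he4]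
      refine (sum_le_sum fun τ hτ => ?_).trans
        (sum_le_univ_sum_of_nonneg fun τ => (Real.exp_pos _).le)
      have h3 : 0 ≤ m - g σ := by linarith
      gcongr
      exact le_max_of_le_left (by linarith [(mem_filter.1 hτ).2])
    have h3 : N * e ^ 4 * r ^ 2 ≤ 2 * N ^ 3 := by
      calc N * e ^ 4 * r ^ 2 ≤ 2 * #(univ.filter fun τ => m ≤ g τ) * e ^ 4 * r ^ 2 := by gcongr
        _ = 2 * (#(univ.filter fun τ => m ≤ g τ) * e ^ 4 * r ^ 2) := by ring
        _ ≤ 2 * N ^ 3 := by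
          gcongr
          exact (mul_le_mul_of_nonneg_right h2 (by positivity)).trans h1
    have h4 : (e ^ 2 * r) ^ 2 ≤ (2 * N) ^ 2 := by
      have : N * (e ^ 2 * r) ^ 2 ≤ N * (2 * N) ^ 2 := by nlinarith [pow_pos hN0 3]
      exact le_of_mul_le_mul_left this hN0
    have h5 : e ^ 2 * r ≤ 2 * N := le_of_sq_le_sq h4 (by positivity)
    rw [← div_eq_mul_inv, le_div_iff₀ (Real.sqrt_pos.2 hr)]
    refine le_of_sq_le_sq ?_ (by positivity)
    rw [mul_pow, mul_pow, Real.sq_sqrt hr.le, Real.sq_sqrt hN0.le]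
    linarith
  have hrank := sum_inv_sqrt_card_le (fun σ => -g σ) univ
  rw [card_univ] at hrank
  calc ∑ σ, Real.exp (1 / 120 * ((g σ - m) / L) ^ 2) ≤
      ∑ σ, (Real.exp (1 / 30 * (max (g σ - m) 0 / L) ^ 2) +
        2 * √N * (√(#(univ.filter fun τ => -g σ ≤ -g τ)))⁻¹) := by
        refine sum_le_sum fun σ _ => ?_
        rcases lt_or_ge (g σ) m with h | h
        · exact (hlower1 σ h).trans (le_add_of_nonneg_left (Real.exp_pos _).le)
        · refine le_trans ?_ (le_add_of_nonneg_right (by positivity))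
          rw [max_eq_left (sub_nonneg.2 h)]
          gcongr
          norm_num
    _ ≤ 4 * N + 2 * √N * (2 * √N) := by
        rw [sum_add_distrib, ← mul_sum]
        gcongr
    _ = 8 * N := by
        linarith [Real.mul_self_sqrt hN0.le]

/-- Moment bound around a median. -/
theorem exists_sum_rpow_le {x : Fin n → ℝ} (hx : ∀ i, x i ∈ Set.Icc (0 : ℝ) 1)
    {L : ℝ≥0} (hL : 0 < L) {f : EuclideanSpace ℝ (Fin n) → ℝ}
    (hf : LipschitzOnWith L f (unitCube n)) (hconv : ConvexOn ℝ (unitCube n) f) :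
    ∃ m, ∀ p : ℝ, 2 ≤ p → ∑ σ, |f (permutedVector x σ) - m| ^ p ≤
      (64 * L * √p) ^ p * Fintype.card (Perm (Fin n)) := by
  have hL' : (0 : ℝ) < L := hL
  obtain ⟨m, hm⟩ := exists_sum_exp_sq_le hx hL hf hconv
  refine ⟨m, fun p hp => ?_⟩
  have hp0 : 0 < p := by linarith
  -- Apply `t ≤ exp t` to `t = (y / L) ^ 2 / (60 p)`, then raise to the power `p / 2`; the constant
  -- `60` is rounded up to `8 ^ 2`.
  have key : ∀ y : ℝ, |y| ^ p ≤ (8 * L * √p) ^ p * Real.exp (1 / 120 * (y / L) ^ 2) := by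
    intro y
    have h1 := Real.add_one_le_exp (1 / 120 * (y / L) ^ 2 * (2 / p))
    have h2 : (1 / 120 * (y / L) ^ 2 * (2 / p)) ≤ Real.exp (1 / 120 * (y / L) ^ 2 * (2 / p)) := by
      linarith
    have h3 : y ^ 2 ≤ (8 * L * √p) ^ 2 * Real.exp (1 / 120 * (y / L) ^ 2 * (2 / p)) := by
      have h4 : y ^ 2 = 60 * L ^ 2 * p * (1 / 120 * (y / L) ^ 2 * (2 / p)) := by
        field_simp
        ring
      have h5 : (8 * L * √p) ^ 2 = 64 * L ^ 2 * p := by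
        rw [mul_pow, mul_pow, Real.sq_sqrt hp0.le]; norm_num
      rw [h5]
      calc y ^ 2 = 60 * L ^ 2 * p * (1 / 120 * (y / L) ^ 2 * (2 / p)) := h4
        _ ≤ 64 * L ^ 2 * p * Real.exp (1 / 120 * (y / L) ^ 2 * (2 / p)) := by
          gcongr
          norm_num
    have h7 := Real.rpow_le_rpow (sq_nonneg y) h3 (by positivity : 0 ≤ p / 2)
    rw [Real.mul_rpow (by positivity) (Real.exp_pos _).le, ← Real.exp_mul, ← sq_abs y,
      ← Real.rpow_natCast_mul (abs_nonneg y), ← Real.rpow_natCast_mul (by positivity)] at h7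
    push_cast at h7
    rw [mul_div_cancel₀ p two_ne_zero] at h7
    convert h7 using 3
    field_simp
  calc _ ≤ ∑ σ, (8 * L * √p) ^ p * Real.exp (1 / 120 * ((f (permutedVector x σ) - m) / L) ^ 2) :=
        sum_le_sum fun σ _ => key _
    _ ≤ (8 * L * √p) ^ p * (8 * Fintype.card (Perm (Fin n))) := by
        rw [← mul_sum]
        gcongr
    _ ≤ (8 * L * √p) ^ p * ((8 : ℝ) ^ p * Fintype.card (Perm (Fin n))) := by
        gcongr
        exact Real.self_le_rpow_of_one_le (by norm_num) (by linarith)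
    _ = _ := by
        rw [← mul_assoc, ← Real.mul_rpow (by positivity) (by positivity)]
        ring_nf

end Concentration

/-! ### From sums over permutations to norms on the probability space. -/

section Transfer

variable {Ω : Type*} [MeasurableSpace Ω] {P : Measure Ω} {n : ℕ} {π : Ω → Perm (Fin n)}

theorem IsUniformPermutation.measurable_comp (hπ : IsUniformPermutation P π) {β : Type*}
    [MeasurableSpace β] (g : Perm (Fin n) → β) : Measurable fun ω => g (π ω) := by
  let : MeasurableSpace (Perm (Fin n)) := ⊤
  exact (measurable_from_top (f := g)).comp (measurable_to_countable' fun σ => (hπ σ).1)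

theorem IsUniformPermutation.lintegral_comp (hπ : IsUniformPermutation P π)
    (g : Perm (Fin n) → ℝ≥0∞) :
    ∫⁻ ω, g (π ω) ∂P = (∑ σ, g σ) * ((n ! : ℕ) : ℝ≥0∞)⁻¹ := by
  let : MeasurableSpace (Perm (Fin n)) := ⊤
  have hm : Measurable π := measurable_to_countable' fun σ => (hπ σ).1
  rw [← lintegral_map (measurable_from_top (f := g)) hm, lintegral_fintype, sum_mul]
  refine sum_congr rfl fun σ _ => ?_
  rw [Measure.map_apply hm (measurableSet_singleton σ), (hπ σ).2]

theorem IsUniformPermutation.eLpNorm_comp_le (hπ : IsUniformPermutation P π)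
    {g : Perm (Fin n) → ℝ} {p B : ℝ} (hp : 0 < p) (hB : 0 ≤ B)
    (h : ∑ σ, |g σ| ^ p ≤ B ^ p * Fintype.card (Perm (Fin n))) :
    eLpNorm (fun ω => g (π ω)) (ENNReal.ofReal p) P ≤ ENNReal.ofReal B := by
  rw [eLpNorm_eq_lintegral_rpow_enorm_toReal (by simpa using hp) ENNReal.ofReal_ne_top,
    ENNReal.toReal_ofReal hp.le, hπ.lintegral_comp fun σ => ‖g σ‖ₑ ^ p, one_div,
    ENNReal.rpow_inv_le_iff hp, ENNReal.ofReal_rpow_of_nonneg hB hp.le]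
  have h1 : ∀ σ, ‖g σ‖ₑ ^ p = ENNReal.ofReal (|g σ| ^ p) := fun σ => by
    rw [Real.enorm_eq_ofReal_abs, ENNReal.ofReal_rpow_of_nonneg (abs_nonneg _) hp.le]
  simp_rw [h1]
  rw [← ENNReal.ofReal_sum_of_nonneg fun σ _ => by positivity, ← div_eq_mul_inv]
  refine ENNReal.div_le_of_le_mul ((ENNReal.ofReal_le_ofReal h).trans (le_of_eq ?_))
  rw [ENNReal.ofReal_mul (by positivity), Fintype.card_perm, Fintype.card_fin,
    ENNReal.ofReal_natCast]

/-- The centre `m` is arbitrary: it is added and subtracted once in the norm of exponent `p` and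
once in exponent 1, which is dominated by exponent `p` on a probability space. -/
theorem eLpNorm_le_eLpNorm_one_add [IsProbabilityMeasure P] {Z : Ω → ℝ} (hZ : Measurable Z)
    (m : ℝ) {p : ℝ≥0∞} (hp : 1 ≤ p) :
    eLpNorm Z p P ≤ eLpNorm Z 1 P + 2 * eLpNorm (fun ω => Z ω - m) p P := by
  have hZm : AEStronglyMeasurable (fun ω => Z ω - m) P := (hZ.sub_const m).aestronglyMeasurable
  have hconst : ∀ q : ℝ≥0∞, q ≠ 0 → eLpNorm (fun _ : Ω => m) q P = ‖m‖ₑ := fun q hq => by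
    rw [eLpNorm_const _ hq (IsProbabilityMeasure.ne_zero P)]
    simp
  have h1 : eLpNorm Z p P ≤ eLpNorm (fun ω => Z ω - m) p P + ‖m‖ₑ := by
    rw [← hconst p (by positivity)]
    refine le_trans (le_of_eq ?_) (eLpNorm_add_le hZm aestronglyMeasurable_const hp)
    congr 1
    ext ω
    simp
  have h2 : ‖m‖ₑ ≤ eLpNorm Z 1 P + eLpNorm (fun ω => Z ω - m) 1 P := by
    rw [← hconst 1 one_ne_zero]
    refine le_trans (le_of_eq ?_) (eLpNorm_sub_le hZ.aestronglyMeasurable hZm le_rfl)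
    congr 1
    ext ω
    simp
  have h3 := eLpNorm_le_eLpNorm_of_exponent_le hp hZm
  calc _ ≤ eLpNorm (fun ω => Z ω - m) p P + (eLpNorm Z 1 P + eLpNorm (fun ω => Z ω - m) p P) :=
        h1.trans (by gcongr; exact h2.trans (by gcongr))
    _ = _ := by ring

end Transfer

/-! ### The moment comparison. -/

theorem mainTheorem6 :
    ∃ C : ℝ, 0 < C ∧
      ∀ (n : ℕ) (x : Fin n → ℝ), (∀ i, x i ∈ Set.Icc (0 : ℝ) 1) →
      ∀ (L : ℝ≥0) (f : EuclideanSpace ℝ (Fin n) → ℝ),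
        LipschitzOnWith L f (unitCube n) → ConvexOn ℝ (unitCube n) f →
      ∀ (Ω : Type*) [MeasurableSpace Ω] (P : Measure Ω) [IsProbabilityMeasure P]
        (π : Ω → Equiv.Perm (Fin n)), IsUniformPermutation P π →
      ∀ p : ℝ, 2 ≤ p →
        eLpNorm (fun ω => f (permutedVector x (π ω))) (ENNReal.ofReal p) P ≤
          eLpNorm (fun ω => f (permutedVector x (π ω))) 1 P
            + ENNReal.ofReal (C * L * √p) := by
  refine ⟨128, by norm_num, ?_⟩
  intro n x hx L f hf hconv Ω _ P _ π hπ p hp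
  have hp0 : 0 < p := by linarith
  obtain ⟨m, hm⟩ : ∃ m, ∑ σ, |f (permutedVector x σ) - m| ^ p ≤
      (64 * L * √p) ^ p * Fintype.card (Perm (Fin n)) := by
    -- The tail bounds divide by `L`; when `L = 0` the function is constant on the cube and its
    -- value serves as centre.
    rcases eq_or_ne L 0 with rfl | hL
    · refine ⟨f (permutedVector x 1), ?_⟩
      have h : ∀ σ, f (permutedVector x σ) = f (permutedVector x 1) := fun σ => by
        have := hf.dist_le_mul _ (permutedVector_mem_unitCube hx σ) _
          (permutedVector_mem_unitCube hx 1)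
        exact dist_le_zero.1 (by simpa using this)
      simp [h, Real.zero_rpow hp0.ne']
    · obtain ⟨m, hm⟩ := exists_sum_rpow_le hx (pos_iff_ne_zero.2 hL) hf hconv
      exact ⟨m, hm p hp⟩
  refine (eLpNorm_le_eLpNorm_one_add (hπ.measurable_comp fun σ => f (permutedVector x σ)) m
    (ENNReal.one_le_ofReal.2 (by linarith))).trans ?_
  gcongr
  have h := hπ.eLpNorm_comp_le hp0 (by positivity) hm
  calc _ ≤ 2 * ENNReal.ofReal (64 * L * √p) := by gcongr
    _ = ENNReal.ofReal (128 * L * √p) := by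
      rw [← ENNReal.ofReal_ofNat 2, ← ENNReal.ofReal_mul zero_le_two]
      congr 1
      ring
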